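/- Let $N\in\mathbb{N}$, let $\mathcal{L}:\mathbb{R}^N\times\mathbb{R}^N\to\mathbb{R}$ and $L_{\mathrm{disc}}:\mathbb{R}^N\times\mathbb{R}^N\times\mathbb{R}_{>0}\to\mathbb{R}$ be smooth, and for a smooth curve $x:\mathbb{R}\to\mathbb{R}^N$ write $[x(t)]=(x(t),\dot x(t),\ddot x(t),\ldots)$. Asymptotic expansions below are for $h\to 0^+$, to every order, locally uniformly in $t$. Assume that $L_{\mathrm{disc}}$ is a consistent discretization of $\mathcal{L}$: there are smooth functions $g_i$ $(i\ge 1)$, each of finitely many of the variables $x,\dot x,\ddot x,\ldots$, such that for every smooth curve $x$ $$L_{\mathrm{disc}}(x(t),x(t+h),h)=\mathcal{L}(x(t),\dot x(t))+\sum_{i\ge 1}h^i g_i[x(t)]$$ as an asymptotic expansion. Then there is a unique formal power series $\mathcal{L}_{\mathrm{disc}}([x],h)=\sum_{k\ge 0}h^k c_k[x]$, with each $c_k$ a smooth function of finitely many of $x,\dot x,\ddot x,\ldots$, such that for every smooth curve $x$ $$L_{\mathrm{disc}}\bigl(x(t-\tfrac h2),x(t+\tfrac h2),h\bigr)=\sum_{k\ge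 0}h^k c_k[x(t)]$$ as an asymptotic expansion. Define the meshed modified Lagrangian as the formal power series $$\mathcal{L}_{\mathrm{mesh}}([x],h)=\sum_{i\ge 0}\bigl(2^{1-2i}-1\bigr)\frac{h^{2i}B_{2i}}{(2i)!}\frac{\mathrm{d}^{2i}}{\mathrm{d}t^{2i}}\mathcal{L}_{\mathrm{disc}}([x],h),$$ where $B_{2i}$ are the Bernoulli numbers and $\frac{\mathrm d}{\mathrm dt}=\sum_j \bigl\langle x^{(j+1)},\frac{\partial}{\partial x^{(j)}}\bigr\rangle$ is the total derivative, applied coefficientwise. Then for every $\ell\ge 1$ the coefficient of $h^\ell$ in $\mathcal{L}_{\mathrm{mesh}}$ depends only on $x,\dot x,\ldots,x^{(\ell)}$, and on no higher derivatives of $x$. -/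

import Mathlib

open Filter Topology Asymptotics
open scoped ContDiff

namespace MeshedLagrangian

/-- A jet of a curve in `ℝ^N` at a point: the sequence `(x, ẋ, ẍ, …)`. -/
abbrev Jet (N : ℕ) : Type := ℕ → EuclideanSpace ℝ (Fin N)

/-- The jet `[x(t)] = (x(t), ẋ(t), ẍ(t), …)` of a curve `x` at time `t`. -/
noncomputable def jet {N : ℕ} (x : ℝ → EuclideanSpace ℝ (Fin N)) (t : ℝ) : Jet N :=
  fun k => iteratedDeriv k x t

/-- `f` is a smooth function of finitely many of the quantities `x, ẋ, ẍ, …`. -/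
def IsSmoothOfFiniteOrder {N : ℕ} (f : Jet N → ℝ) : Prop :=
  ∃ (n : ℕ) (F : (Fin n → EuclideanSpace ℝ (Fin N)) → ℝ),
    ContDiff ℝ ∞ F ∧ ∀ u : Jet N, f u = F (fun i => u i)

/-- The total time derivative `d/dt`: for a smooth function `f` of finitely many derivatives this is
`∑ j, ⟨∂f/∂x^(j), x^(j+1)⟩`, the derivative of `f` in the direction of the shifted jet. -/
noncomputable def totalDeriv {N : ℕ} (f : Jet N → ℝ) : Jet N → ℝ :=
  fun u => deriv (fun s : ℝ => f (fun j => u j + s • u (j + 1))) 0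

/-- The quantity `f x t h` (depending on a curve, a time and a step size) has the expansion
`f x t h = ∑ k, h^k c_k[x(t)]` along every smooth curve, with smooth coefficients `c_k` of finite
order. The series is an asymptotic expansion for `h → 0⁺`, locally uniformly in `t`. -/
def HasExpansion {N : ℕ} (f : (ℝ → EuclideanSpace ℝ (Fin N)) → ℝ → ℝ → ℝ)
    (c : ℕ → Jet N → ℝ) : Prop :=
  (∀ k, IsSmoothOfFiniteOrder (c k)) ∧
    ∀ x : ℝ → EuclideanSpace ℝ (Fin N), ContDiff ℝ ∞ x → ∀ (t₀ : ℝ) (n : ℕ),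
      (fun p : ℝ × ℝ => f x p.1 p.2 - ∑ k ∈ Finset.range n, p.2 ^ k * c k (jet x p.1))
        =O[𝓝 t₀ ×ˢ 𝓝[>] (0 : ℝ)] (fun p : ℝ × ℝ => p.2 ^ n)

/-- `Ldisc` is a consistent discretization of `L`: along smooth curves,
`Ldisc (x(t), x(t+h), h) = L (x(t), ẋ(t)) + ∑_{i ≥ 1} h^i g_i[x(t)]`. -/
def IsConsistentDiscretization {N : ℕ}
    (Ldisc : EuclideanSpace ℝ (Fin N) → EuclideanSpace ℝ (Fin N) → ℝ → ℝ)
    (L : EuclideanSpace ℝ (Fin N) → EuclideanSpace ℝ (Fin N) → ℝ) : Prop :=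
  ∃ g : ℕ → Jet N → ℝ, (∀ u : Jet N, g 0 u = L (u 0) (u 1)) ∧
    HasExpansion (fun x t h => Ldisc (x t) (x (t + h)) h) g

/-- `∑ k, h^k c_k[x]` is the power series `𝓛_disc([x], h)`, i.e. the expansion of
`Ldisc (x(t - h/2), x(t + h/2), h)` in terms of `x` and its derivatives at time `t`. -/
def IsDiscreteLagrangianSeries {N : ℕ}
    (Ldisc : EuclideanSpace ℝ (Fin N) → EuclideanSpace ℝ (Fin N) → ℝ → ℝ)
    (c : ℕ → Jet N → ℝ) : Prop :=
  HasExpansion (fun x t h => Ldisc (x (t - h / 2)) (x (t + h / 2)) h) c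

/-- The `h^l`-term of the meshed modified Lagrangian
`𝓛_mesh = ∑ i, (2^(1-2i) - 1) h^(2i) B_{2i} / (2i)! (d/dt)^(2i) 𝓛_disc`,
where `𝓛_disc = ∑ k, h^k c_k`. -/
noncomputable def meshTerm {N : ℕ} (c : ℕ → Jet N → ℝ) (l : ℕ) : Jet N → ℝ :=
  fun u => ∑ i ∈ Finset.range (l / 2 + 1),
    ((2 : ℝ) ^ (1 - 2 * (i : ℤ)) - 1) * ((bernoulli (2 * i) : ℚ) : ℝ) / ((2 * i).factorial : ℝ)
      * (totalDeriv^[2 * i] (c (l - 2 * i))) u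

end MeshedLagrangian

/-! Write `c_k` for the coefficients of the discrete Lagrangian series. The expanded quantity sees
the curve only through its two values at `t ± h/2`, so the series cannot react to a perturbation
vanishing at both points. Take `P - h^2 Q` with `P = t^(m+2)/(m+2)! v` and `Q = t^m/m! v /
(4(m+1)(m+2))`. Comparing powers of `h` gives `∂c_{k+2}/∂x^(m+2) = ∂c_k/∂x^(m) / (4(m+1)(m+2))`, and
`∂c_k/∂x^(m+2) = 0` for `k < 2` (`IsTwoPointSeries`).

Hence `c_k` has order at most `k + 1`. Its derivative in `x^(k+1)` is `(1/2)^k/(k+1)! ∂c_0/∂ẋ` for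
even `k`, and zero for odd `k`. Each `d/dt` raises the order by one and preserves the top partial
derivative, so the `h^l` term has order at most `l + 1`. For even `l`, its derivative in `x^(l+1)`
is `∂c_0/∂ẋ` times the coefficient of `z^l` in `(z/2)/sinh(z/2) * sinh(z/2)/(z/2) = 1`, hence zero.

The analytic difficulty is that the expansion holds curve by curve, while the perturbation depends
on `h`. `exists_contDiff_eq_near_seq` places perturbations for a sequence `h n` in one smooth curve,
near times `t n → 0`; local uniformity in `t` then permits the comparison in
`IsDiscreteLagrangianSeries.dirDeriv_eq`. Existence of the series comes from recentering
(`HasExpansion.shift_time`), uniqueness from polynomial curves (`HasExpansion.unique`). -/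

namespace MeshedLagrangian

variable {N : ℕ}

/-! ### Differential calculus for functions of finitely many jet variables. -/

/-- The derivative of `f` at `u` in the direction of the jet `w`. -/
noncomputable def dirDeriv (f : Jet N → ℝ) (w u : Jet N) : ℝ :=
  deriv (fun s : ℝ => f (u + s • w)) 0

/-- The shifted jet `(ẋ, ẍ, …)`. -/
def shift (u : Jet N) : Jet N := fun j => u (j + 1)

lemma totalDeriv_eq_dirDeriv (f : Jet N → ℝ) (u : Jet N) :
    totalDeriv f u = dirDeriv f (shift u) u := rfl

/-- The first `n` entries of a jet. -/
def trunc (n : ℕ) (u : Jet N) : Fin n → EuclideanSpace ℝ (Fin N) := fun i => u i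

lemma trunc_add (n : ℕ) (u v : Jet N) : trunc n (u + v) = trunc n u + trunc n v := rfl

lemma trunc_smul (n : ℕ) (s : ℝ) (v : Jet N) : trunc n (s • v) = s • trunc n v := rfl

namespace IsSmoothOfFiniteOrder

lemma contDiff_comp {f : Jet N → ℝ} (hf : IsSmoothOfFiniteOrder f)
    {X : Type*} [NormedAddCommGroup X] [NormedSpace ℝ X] {γ : X → Jet N}
    (hγ : ∀ i, ContDiff ℝ ∞ (fun t => γ t i)) : ContDiff ℝ ∞ (fun t => f (γ t)) := by
  obtain ⟨n, F, hF, hfF⟩ := hf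
  simp only [hfF]
  exact hF.comp (contDiff_pi.2 fun i => hγ i)

lemma continuous {f : Jet N → ℝ} (hf : IsSmoothOfFiniteOrder f) : Continuous f := by
  obtain ⟨n, F, hF, hfF⟩ := hf
  rw [funext hfF]
  exact hF.continuous.comp (by fun_prop)

lemma of_trunc {f : Jet N → ℝ} (n : ℕ) (F : (Fin n → EuclideanSpace ℝ (Fin N)) → ℝ)
    (hF : ContDiff ℝ ∞ F) (h : ∀ u, f u = F (trunc n u)) : IsSmoothOfFiniteOrder f :=
  ⟨n, F, hF, h⟩

/-- Chain rule along a curve of jets. -/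
lemma hasDerivAt_trunc {f : Jet N → ℝ} {n : ℕ} {F : (Fin n → EuclideanSpace ℝ (Fin N)) → ℝ}
    (hF : ContDiff ℝ ∞ F) (h : ∀ u, f u = F (trunc n u)) {γ : ℝ → Jet N} {γ' : Jet N} {t : ℝ}
    (hγ : ∀ i, HasDerivAt (fun t => γ t i) (γ' i) t) :
    HasDerivAt (fun t => f (γ t)) (fderiv ℝ F (trunc n (γ t)) (trunc n γ')) t := by
  simp only [h]
  have h1 : HasDerivAt (fun t => trunc n (γ t)) (trunc n γ') t :=
    hasDerivAt_pi.2 fun i => hγ i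
  exact ((hF.differentiable (by simp)) _).hasFDerivAt.comp_hasDerivAt t h1

lemma hasDerivAt_line (u w : Jet N) (s : ℝ) (i : ℕ) :
    HasDerivAt (fun s : ℝ => (u + s • w) i) (w i) s := by
  have := ((hasDerivAt_id s).smul_const (w i)).const_add (u i)
  simpa using this

lemma dirDeriv_trunc {f : Jet N → ℝ} {n : ℕ} {F : (Fin n → EuclideanSpace ℝ (Fin N)) → ℝ}
    (hF : ContDiff ℝ ∞ F) (h : ∀ u, f u = F (trunc n u)) (w u : Jet N) :
    dirDeriv f w u = fderiv ℝ F (trunc n u) (trunc n w) := by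
  have := (hasDerivAt_trunc hF h (fun i => hasDerivAt_line u w 0 i)).deriv
  rwa [zero_smul, add_zero] at this

lemma hasDerivAt {f : Jet N → ℝ} (hf : IsSmoothOfFiniteOrder f) {γ : ℝ → Jet N} {γ' : Jet N}
    {t : ℝ} (hγ : ∀ i, HasDerivAt (fun t => γ t i) (γ' i) t) :
    HasDerivAt (fun t => f (γ t)) (dirDeriv f γ' (γ t)) t := by
  obtain ⟨n, F, hF, hfF⟩ := hf
  rw [dirDeriv_trunc hF hfF]
  exact hasDerivAt_trunc hF hfF hγ

lemma hasDerivAt_add_smul {f : Jet N → ℝ} (hf : IsSmoothOfFiniteOrder f) (u w : Jet N) (s : ℝ) :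
    HasDerivAt (fun s : ℝ => f (u + s • w)) (dirDeriv f w (u + s • w)) s :=
  hf.hasDerivAt (hasDerivAt_line u w s)

lemma dirDeriv_add {f : Jet N → ℝ} (hf : IsSmoothOfFiniteOrder f) (v w u : Jet N) :
    dirDeriv f (v + w) u = dirDeriv f v u + dirDeriv f w u := by
  obtain ⟨n, F, hF, hfF⟩ := hf
  simp [dirDeriv_trunc hF hfF, trunc_add]

lemma dirDeriv_smul {f : Jet N → ℝ} (hf : IsSmoothOfFiniteOrder f) (s : ℝ) (w u : Jet N) :
    dirDeriv f (s • w) u = s * dirDeriv f w u := by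
  obtain ⟨n, F, hF, hfF⟩ := hf
  simp [dirDeriv_trunc hF hfF, trunc_smul]

lemma dirDeriv {f : Jet N → ℝ} (hf : IsSmoothOfFiniteOrder f) (w : Jet N) :
    IsSmoothOfFiniteOrder (dirDeriv f w) := by
  obtain ⟨n, F, hF, hfF⟩ := hf
  refine of_trunc n (fun a => fderiv ℝ F a (trunc n w)) ?_ (dirDeriv_trunc hF hfF w)
  exact (hF.fderiv_right (m := ∞) (by simp)).clm_apply contDiff_const

lemma totalDeriv {f : Jet N → ℝ} (hf : IsSmoothOfFiniteOrder f) :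
    IsSmoothOfFiniteOrder (totalDeriv f) := by
  obtain ⟨n, F, hF, hfF⟩ := hf
  refine of_trunc (n + 1) (fun a => fderiv ℝ F (fun i => a i.castSucc) (fun i => a i.succ)) ?_ ?_
  · refine ContDiff.clm_apply ?_ (contDiff_pi.2 fun i => contDiff_apply _ _ _)
    exact (hF.fderiv_right (m := ∞) (by simp)).comp (contDiff_pi.2 fun i => contDiff_apply _ _ _)
  · intro u
    rw [totalDeriv_eq_dirDeriv, dirDeriv_trunc hF hfF]
    congr 1

lemma iterate_totalDeriv {f : Jet N → ℝ} (hf : IsSmoothOfFiniteOrder f) (n : ℕ) :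
    IsSmoothOfFiniteOrder (MeshedLagrangian.totalDeriv^[n] f) := by
  induction n with
  | zero => exact hf
  | succ n ih => rw [Function.iterate_succ_apply']; exact ih.totalDeriv

lemma const_mul {f : Jet N → ℝ} (hf : IsSmoothOfFiniteOrder f) (a : ℝ) :
    IsSmoothOfFiniteOrder (fun u => a * f u) := by
  obtain ⟨n, F, hF, hfF⟩ := hf
  exact ⟨n, fun v => a * F v, contDiff_const.mul hF, fun u => by simp only [hfF]⟩

lemma add {f g : Jet N → ℝ} (hf : IsSmoothOfFiniteOrder f) (hg : IsSmoothOfFiniteOrder g) :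
    IsSmoothOfFiniteOrder (fun u => f u + g u) := by
  obtain ⟨n, F, hF, hfF⟩ := hf
  obtain ⟨m, G, hG, hgG⟩ := hg
  refine of_trunc (n + m) (fun a => F (fun i => a (i.castAdd m)) +
    G (fun i => a (i.castLE (Nat.le_add_left m n)))) ?_ ?_
  · exact (hF.comp (contDiff_pi.2 fun i => contDiff_apply _ _ _)).add
      (hG.comp (contDiff_pi.2 fun i => contDiff_apply _ _ _))
  · intro u
    rw [hfF, hgG]
    rfl

lemma sum {ι : Type*} (s : Finset ι) {f : ι → Jet N → ℝ}
    (hf : ∀ i ∈ s, IsSmoothOfFiniteOrder (f i)) :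
    IsSmoothOfFiniteOrder (fun u => ∑ i ∈ s, f i u) := by
  classical
  induction s using Finset.induction_on with
  | empty => exact ⟨0, fun _ => 0, contDiff_const, fun u => by simp⟩
  | insert a s ha ih =>
    simp only [Finset.sum_insert ha]
    exact (hf a (by simp)).add (ih fun i hi => hf i (by simp [hi]))

lemma dependsOn_Iio {f : Jet N → ℝ} (hf : IsSmoothOfFiniteOrder f) :
    ∃ n, DependsOn f (Set.Iio n) := by
  obtain ⟨n, F, -, hfF⟩ := hf
  refine ⟨n, fun u v huv => ?_⟩
  rw [hfF, hfF]
  congr 1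
  ext1 i
  exact huv i i.2

/-- A function all of whose partial derivatives in the variables of order above `m` vanish depends
only on the variables of order at most `m`. -/
lemma dependsOn_of_dirDeriv_eq_zero {f : Jet N → ℝ} (hf : IsSmoothOfFiniteOrder f) (m : ℕ)
    (h : ∀ j, m < j → ∀ v u, MeshedLagrangian.dirDeriv f (Pi.single j v) u = 0) :
    DependsOn f (Set.Iic m) := by
  intro u v huv
  have key : ∀ z, MeshedLagrangian.dirDeriv f (v - u) z = 0 := by
    intro z
    obtain ⟨n, F, hF, hfF⟩ := hf
    -- The jet `v - u` may have infinitely many nonzero entries, but `f` sees only the first `n`, so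
    -- its direction splits into finitely many coordinate directions.
    have h1 : trunc n (v - u) = ∑ i : Fin n, trunc n (Pi.single (i : ℕ) (v i - u i)) := by
      ext1 j
      rw [Finset.sum_apply, Finset.sum_eq_single j]
      · simp [trunc]
      · intro b _ hb
        have : (j : ℕ) ≠ b := fun h => hb (Fin.ext h.symm)
        simp [trunc, this]
      · simp
    rw [dirDeriv_trunc hF hfF, h1, map_sum]
    refine Finset.sum_eq_zero fun i _ => ?_
    rw [← dirDeriv_trunc hF hfF]
    by_cases hi : (i : ℕ) ≤ m
    · rw [huv i hi, sub_self, Pi.single_zero, dirDeriv_trunc hF hfF]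
      exact map_zero _
    · exact h i (by omega) _ _
  have hd := fun s => (hf.hasDerivAt_add_smul u (v - u) s)
  have := is_const_of_deriv_eq_zero (fun s => (hd s).differentiableAt)
    (fun s => by rw [(hd s).deriv, key]) 0 1
  simpa using this

end IsSmoothOfFiniteOrder

/-! ### Order of a function and the total derivative. -/

lemma dirDeriv_single_eq_zero {f : Jet N → ℝ} {m j : ℕ} (h : DependsOn f (Set.Iic m)) (hj : m < j)
    (v : EuclideanSpace ℝ (Fin N)) (u : Jet N) : dirDeriv f (Pi.single j v) u = 0 := by
  have : (fun s : ℝ => f (u + s • (Pi.single j v : Jet N))) = fun _ => f u := by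
    ext s
    apply h
    intro i hi
    have : i ≠ j := by have := Set.mem_Iic.1 hi; omega
    simp [this]
  rw [dirDeriv, this, deriv_const]

lemma dependsOn_totalDeriv {f : Jet N → ℝ} {m : ℕ} (h : DependsOn f (Set.Iic m)) :
    DependsOn (totalDeriv f) (Set.Iic (m + 1)) := by
  intro u v huv
  have : (fun s : ℝ => f (fun j => u j + s • u (j + 1))) =
      fun s : ℝ => f (fun j => v j + s • v (j + 1)) := by
    ext s
    apply h
    intro i hi
    have := Set.mem_Iic.1 hi
    rw [huv i (Set.mem_Iic.2 (by omega)), huv (i + 1) (Set.mem_Iic.2 (by omega))]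
  rw [totalDeriv, totalDeriv, this]

lemma dependsOn_iterate_totalDeriv {f : Jet N → ℝ} {m : ℕ} (h : DependsOn f (Set.Iic m)) (n : ℕ) :
    DependsOn (totalDeriv^[n] f) (Set.Iic (m + n)) := by
  induction n with
  | zero => exact h
  | succ n ih => rw [Function.iterate_succ_apply']; exact dependsOn_totalDeriv ih

lemma dirDeriv_congr {f : Jet N → ℝ} {m : ℕ} (h : DependsOn f (Set.Iic m)) {w u w' u' : Jet N}
    (hw : ∀ i ≤ m, w i = w' i) (hu : ∀ i ≤ m, u i = u' i) : dirDeriv f w u = dirDeriv f w' u' := by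
  have : (fun s : ℝ => f (u + s • w)) = fun s : ℝ => f (u' + s • w') := by
    ext s
    apply h
    intro i hi
    simp [hw i hi, hu i hi]
  rw [dirDeriv, dirDeriv, this]

/-- The top partial derivative is unchanged by the total derivative. -/
lemma dirDeriv_totalDeriv_top {f : Jet N → ℝ} (hf : IsSmoothOfFiniteOrder f) {m : ℕ}
    (h : DependsOn f (Set.Iic m)) (v : EuclideanSpace ℝ (Fin N)) (u : Jet N) :
    dirDeriv (totalDeriv f) (Pi.single (m + 1) v) u = dirDeriv f (Pi.single m v) u := by
  -- Moving `x^(m+1)` leaves the base point of `f` unchanged up to order `m`; it only moves entry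
  -- `m` of the shifted jet, in which the total derivative is linear.
  have : (fun s : ℝ => totalDeriv f (u + s • (Pi.single (m + 1) v : Jet N))) =
      fun s : ℝ => totalDeriv f u + s * dirDeriv f (Pi.single m v) u := by
    ext s
    rw [totalDeriv_eq_dirDeriv, totalDeriv_eq_dirDeriv, ← hf.dirDeriv_smul, ← hf.dirDeriv_add]
    apply dirDeriv_congr h
    · intro i _
      simp [shift, Pi.single_apply]
    · intro i hi
      have : i ≠ m + 1 := by omega
      simp [this]
  rw [dirDeriv, this]
  simp

lemma dirDeriv_iterate_totalDeriv_top {f : Jet N → ℝ} (hf : IsSmoothOfFiniteOrder f) {m : ℕ}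
    (h : DependsOn f (Set.Iic m)) (n : ℕ) (v : EuclideanSpace ℝ (Fin N)) (u : Jet N) :
    dirDeriv (totalDeriv^[n] f) (Pi.single (m + n) v) u = dirDeriv f (Pi.single m v) u := by
  induction n with
  | zero => rfl
  | succ n ih =>
    rw [Function.iterate_succ_apply', ← ih]
    exact dirDeriv_totalDeriv_top (hf.iterate_totalDeriv n) (dependsOn_iterate_totalDeriv h n) v u

lemma dirDeriv_const_mul {f : Jet N → ℝ} (a : ℝ) (w u : Jet N) :
    dirDeriv (fun u => a * f u) w u = a * dirDeriv f w u := by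
  simp only [dirDeriv, deriv_const_mul_field]

lemma dirDeriv_sum {ι : Type*} (s : Finset ι) {f : ι → Jet N → ℝ}
    (hf : ∀ i ∈ s, IsSmoothOfFiniteOrder (f i)) (w u : Jet N) :
    dirDeriv (fun u => ∑ i ∈ s, f i u) w u = ∑ i ∈ s, dirDeriv (f i) w u := by
  have := HasDerivAt.fun_sum fun i hi => (hf i hi).hasDerivAt_add_smul u w 0
  simp only [zero_smul, add_zero] at this
  exact this.deriv

/-! ### Expansions along curves: Taylor's formula and recentering. -/

lemma hasDerivAt_jet {x : ℝ → EuclideanSpace ℝ (Fin N)} (hx : ContDiff ℝ ∞ x) (t : ℝ) (i : ℕ) :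
    HasDerivAt (fun t => jet x t i) (shift (jet x t) i) t := by
  simp only [jet, shift, iteratedDeriv_succ]
  exact ((hx.differentiable_iteratedDeriv i (by exact_mod_cast ENat.natCast_lt_top i)) t).hasDerivAt

lemma contDiff_jet {x : ℝ → EuclideanSpace ℝ (Fin N)} (hx : ContDiff ℝ ∞ x) (i : ℕ) :
    ContDiff ℝ ∞ (fun t => jet x t i) := by
  simp only [jet, iteratedDeriv_eq_iterate]
  exact hx.iterate_deriv i

/-- The total derivative of `f` computes the time derivatives of `f[x(t)]`. -/
lemma iteratedDeriv_comp_jet {f : Jet N → ℝ} (hf : IsSmoothOfFiniteOrder f)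
    {x : ℝ → EuclideanSpace ℝ (Fin N)} (hx : ContDiff ℝ ∞ x) (n : ℕ) :
    iteratedDeriv n (fun t => f (jet x t)) = fun t => totalDeriv^[n] f (jet x t) := by
  induction n with
  | zero => simp
  | succ n ih =>
    rw [iteratedDeriv_succ, ih, Function.iterate_succ_apply']
    ext t
    exact ((hf.iterate_totalDeriv n).hasDerivAt (hasDerivAt_jet hx t)).deriv

/-- Taylor expansion with a remainder that is locally uniform in the base point. -/
lemma taylor_isBigO {ψ : ℝ → ℝ} (hψ : ContDiff ℝ ∞ ψ) (t₀ a : ℝ) (n : ℕ) :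
    (fun p : ℝ × ℝ => ψ (p.1 + a * p.2) -
      ∑ j ∈ Finset.range n, (a * p.2) ^ j / (j.factorial : ℝ) * iteratedDeriv j ψ p.1)
      =O[𝓝 t₀ ×ˢ 𝓝[>] (0 : ℝ)] (fun p : ℝ × ℝ => p.2 ^ n) := by
  have hcont : Continuous (iteratedDeriv n ψ) :=
    hψ.continuous_iteratedDeriv n (by exact_mod_cast le_top)
  -- This interval contains every point between `t` and `t + a * h` for `|t - t₀| ≤ 1` and `0 < h ≤
  -- 1`.
  obtain ⟨C, hC⟩ := (isCompact_Icc (a := t₀ - 1 - |a|)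
    (b := t₀ + 1 + |a|)).exists_bound_of_continuousOn hcont.continuousOn
  refine IsBigO.of_bound (C * |a| ^ n) ?_
  have h1 : ∀ᶠ t in 𝓝 t₀, t ∈ Set.Icc (t₀ - 1) (t₀ + 1) :=
    Icc_mem_nhds (by linarith) (by linarith)
  have h2 : ∀ᶠ h in 𝓝[>] (0 : ℝ), h ∈ Set.Ioc (0 : ℝ) 1 :=
    Ioc_mem_nhdsGT zero_lt_one
  filter_upwards [h1.prod_mk h2] with p hp
  obtain ⟨t, h⟩ := p
  obtain ⟨⟨ht1, ht2⟩, hh1, hh2⟩ := hp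
  simp only at ht1 ht2 hh1 hh2 ⊢
  have hah : |a * h| ≤ |a| := by
    rw [abs_mul, abs_of_pos hh1]
    exact mul_le_of_le_one_right (abs_nonneg a) hh2
  have habs := abs_le.1 hah
  have hanonneg := abs_nonneg a
  have hCn : 0 ≤ C := (norm_nonneg _).trans (hC t ⟨by linarith, by linarith⟩)
  rw [Real.norm_eq_abs, Real.norm_eq_abs, abs_pow, abs_of_pos hh1]
  cases n with
  | zero =>
    simp only [Finset.range_zero, Finset.sum_empty, sub_zero, pow_zero, mul_one]
    have := hC (t + a * h) ⟨by linarith, by linarith⟩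
    simpa using this
  | succ n =>
    by_cases hne : t = t + a * h
    · have h0 : a * h = 0 := by linarith
      rw [h0, Finset.sum_eq_single 0]
      · simp only [add_zero, pow_zero, Nat.factorial_zero, Nat.cast_one, div_one, one_mul,
          iteratedDeriv_zero, sub_self, abs_zero]
        positivity
      · intro j _ hj
        simp [hj]
      · simp
    · obtain ⟨y, hy, hy2⟩ := taylor_mean_remainder_lagrange_iteratedDeriv (n := n) hne
        ((hψ.of_le (by exact_mod_cast le_top)).contDiffOn)
      have hsum : taylorWithinEval ψ n (Set.uIcc t (t + a * h)) t (t + a * h) =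
          ∑ j ∈ Finset.range (n + 1), (a * h) ^ j / (j.factorial : ℝ) * iteratedDeriv j ψ t := by
        rw [taylor_within_apply]
        refine Finset.sum_congr rfl fun j _ => ?_
        rw [iteratedDerivWithin_eq_iteratedDeriv (uniqueDiffOn_uIcc hne)
          (hψ.of_le (by exact_mod_cast le_top)).contDiffAt Set.left_mem_uIcc, smul_eq_mul,
          add_sub_cancel_left]
        ring
      rw [← hsum, hy2, add_sub_cancel_left]
      have hyI : y ∈ Set.Icc (t₀ - 1 - |a|) (t₀ + 1 + |a|) := by
        have := Set.uIoo_subset_uIcc_self hy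
        rw [Set.mem_uIcc] at this
        constructor <;> rcases this with h | h <;> linarith [h.1, h.2]
      have hb := hC y hyI
      rw [Real.norm_eq_abs] at hb
      rw [abs_div, abs_mul, abs_pow, abs_mul, abs_of_pos hh1, Nat.abs_cast, mul_pow]
      have hf1 : (1 : ℝ) ≤ ((n + 1).factorial : ℝ) := by
        exact_mod_cast Nat.one_le_iff_ne_zero.2 (Nat.factorial_ne_zero _)
      calc _ ≤ |iteratedDeriv (n + 1) ψ y| * (|a| ^ (n + 1) * h ^ (n + 1)) :=
            div_le_self (by positivity) hf1
        _ ≤ C * (|a| ^ (n + 1) * h ^ (n + 1)) := by gcongr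
        _ = _ := by ring

/-- Recentering an expansion at a shifted time. -/
lemma HasExpansion.shift_time {f : (ℝ → EuclideanSpace ℝ (Fin N)) → ℝ → ℝ → ℝ}
    {g : ℕ → Jet N → ℝ} (hg : HasExpansion f g) (a : ℝ) :
    HasExpansion (fun x t h => f x (t + a * h) h) (fun k u => ∑ i ∈ Finset.range (k + 1),
      a ^ (k - i) / ((k - i).factorial : ℝ) * totalDeriv^[k - i] (g i) u) := by
  obtain ⟨hs, hO⟩ := hg
  refine ⟨fun k => .sum _ fun i _ => ((hs i).iterate_totalDeriv _).const_mul _, ?_⟩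
  intro x hx t₀ n
  -- Local uniformity in `t` is what allows an `h`-dependent time to be substituted.
  have htend : Tendsto (fun p : ℝ × ℝ => (p.1 + a * p.2, p.2)) (𝓝 t₀ ×ˢ 𝓝[>] (0 : ℝ))
      (𝓝 t₀ ×ˢ 𝓝[>] (0 : ℝ)) := by
    refine Tendsto.prodMk ?_ tendsto_snd
    have h2 : Tendsto (fun p : ℝ × ℝ => p.2) (𝓝 t₀ ×ˢ 𝓝[>] (0 : ℝ)) (𝓝 0) :=
      tendsto_snd.mono_right nhdsWithin_le_nhds
    simpa using (tendsto_fst (f := 𝓝 t₀) (g := 𝓝[>] (0 : ℝ))).add (h2.const_mul a)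
  have h1 := (hO x hx t₀ n).comp_tendsto htend
  have h2 : ∀ i ∈ Finset.range n, (fun p : ℝ × ℝ => p.2 ^ i * (g i (jet x (p.1 + a * p.2)) -
      ∑ j ∈ Finset.range (n - i), (a * p.2) ^ j / (j.factorial : ℝ) *
        totalDeriv^[j] (g i) (jet x p.1))) =O[𝓝 t₀ ×ˢ 𝓝[>] (0 : ℝ)]
        (fun p : ℝ × ℝ => p.2 ^ n) := by
    intro i hi
    have := taylor_isBigO ((hs i).contDiff_comp (contDiff_jet hx)) t₀ a (n - i)
    simp only [iteratedDeriv_comp_jet (hs i) hx] at this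
    have h3 := (isBigO_refl (fun p : ℝ × ℝ => p.2 ^ i) (𝓝 t₀ ×ˢ 𝓝[>] (0 : ℝ))).mul this
    have h4 : ∀ p : ℝ × ℝ, p.2 ^ i * p.2 ^ (n - i) = p.2 ^ n := fun p => by
      rw [← pow_add, Nat.add_sub_cancel' (Finset.mem_range.1 hi).le]
    simpa only [h4] using h3
  refine (h1.add (IsBigO.fun_sum h2)).congr_left fun p => ?_
  simp only [Function.comp_def, mul_sub, Finset.sum_sub_distrib, Finset.mul_sum]
  rw [sub_add_sub_cancel]
  congr 1
  -- The new coefficients are those of `exp(a h d/dt)` applied to the old series, so the double sum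
  -- is regrouped by total degree `k = i + j`.
  rw [← Finset.sum_range_diag_flip n fun i j => p.2 ^ i * ((a * p.2) ^ j / (j.factorial : ℝ) *
        totalDeriv^[j] (g i) (jet x p.1))]
  refine Finset.sum_congr rfl fun k _ => Finset.sum_congr rfl fun i hi => ?_
  have : p.2 ^ k = p.2 ^ i * p.2 ^ (k - i) := by
    rw [← pow_add, Nat.add_sub_cancel' (Finset.mem_range_succ_iff.1 hi)]
  rw [this, mul_pow]
  ring

/-! ### Realizing jets by polynomials; uniqueness of coefficients. -/

/-- The polynomial curve with the first `n` derivatives prescribed at time `0`. -/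
noncomputable def polyCurve (n : ℕ) (u : Jet N) (t : ℝ) : EuclideanSpace ℝ (Fin N) :=
  ∑ i ∈ Finset.range n, (t ^ i / (i.factorial : ℝ)) • u i

lemma contDiff_polyCurve (n : ℕ) (u : Jet N) : ContDiff ℝ ∞ (polyCurve n u) := by
  unfold polyCurve
  fun_prop

lemma iteratedDeriv_monomial_smul (i k : ℕ) (v : EuclideanSpace ℝ (Fin N)) (t : ℝ) :
    iteratedDeriv k (fun t : ℝ => (t ^ i / (i.factorial : ℝ)) • v) t =
      if k ≤ i then (t ^ (i - k) / ((i - k).factorial : ℝ)) • v else 0 := by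
  induction k generalizing t with
  | zero => simp
  | succ k ih =>
    rw [iteratedDeriv_succ, funext ih]
    by_cases hk : k + 1 ≤ i
    · rw [if_pos hk]
      simp only [if_pos (Nat.le_of_succ_le hk)]
      obtain ⟨d, rfl⟩ := Nat.exists_eq_add_of_le hk
      have e1 : k + 1 + d - k = d + 1 := by omega
      have e2 : k + 1 + d - (k + 1) = d := by omega
      rw [e1, e2]
      have := (((hasDerivAt_pow (d + 1) t).div_const ((d + 1).factorial : ℝ)).smul_const v).deriv
      rw [this]
      congr 1
      rw [Nat.factorial_succ, Nat.add_sub_cancel]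
      push_cast
      have : (d.factorial : ℝ) ≠ 0 := by exact_mod_cast d.factorial_ne_zero
      field_simp
    · rw [if_neg hk]
      by_cases hk' : k ≤ i
      · have : i - k = 0 := by omega
        simp [hk', this]
      · simp [hk']

lemma jet_polyCurve (n : ℕ) (u : Jet N) (k : ℕ) (hk : k < n) : jet (polyCurve n u) 0 k = u k := by
  unfold jet polyCurve
  rw [iteratedDeriv_fun_sum]
  · simp only [iteratedDeriv_monomial_smul]
    rw [Finset.sum_eq_single k]
    · simp
    · intro i _ hi
      split_ifs with h
      · have : i - k ≠ 0 := by omega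
        simp [this]
      · rfl
    · simp [hk]
  · intro i _
    fun_prop

/-- The coefficients of an expansion are unique. -/
lemma HasExpansion.unique {f : (ℝ → EuclideanSpace ℝ (Fin N)) → ℝ → ℝ → ℝ}
    {c d : ℕ → Jet N → ℝ} (hc : HasExpansion f c) (hd : HasExpansion f d) : c = d := by
  suffices h : ∀ k u, c k u = d k u from funext fun k => funext fun u => h k u
  intro k
  induction k using Nat.strong_induction_on with
  | _ k ih =>
  intro u
  obtain ⟨n, hn⟩ := (hc.1 k).dependsOn_Iio
  obtain ⟨m, hm⟩ := (hd.1 k).dependsOn_Iio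
  have hx := contDiff_polyCurve (n + m) u
  set x := polyCurve (n + m) u with hxdef
  have e1 : c k u = c k (jet x 0) := hn fun i hi => by
    have := Set.mem_Iio.1 hi
    rw [hxdef, jet_polyCurve _ _ _ (by omega)]
  have e2 : d k u = d k (jet x 0) := hm fun i hi => by
    have := Set.mem_Iio.1 hi
    rw [hxdef, jet_polyCurve _ _ _ (by omega)]
  have h1 := (hd.2 x hx 0 (k + 1)).sub (hc.2 x hx 0 (k + 1))
  have htend : Tendsto (fun h : ℝ => ((0 : ℝ), h)) (𝓝[>] (0 : ℝ)) (𝓝 0 ×ˢ 𝓝[>] (0 : ℝ)) :=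
    tendsto_const_nhds.prodMk tendsto_id
  have h2 := h1.comp_tendsto htend
  -- By induction the lower terms cancel; what is left is `O(h^(k+1))` although it carries only
  -- `h^k`, so its constant factor is zero.
  have h3 : (fun h : ℝ => h ^ k * (c k u - d k u)) =O[𝓝[>] (0 : ℝ)] fun h => h ^ k * h := by
    refine h2.congr (fun h => ?_) (fun h => by simp [pow_succ])
    simp only [Function.comp_def, Finset.sum_range_succ]
    rw [Finset.sum_congr rfl fun i hi => by rw [← ih i (Finset.mem_range.1 hi) (jet x 0)], e1, e2]
    ring
  have hpos : ∀ᶠ h in 𝓝[>] (0 : ℝ), 0 < h := self_mem_nhdsWithin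
  have h4 : (fun _ : ℝ => c k u - d k u) =O[𝓝[>] (0 : ℝ)] fun h => h := by
    refine ((isBigO_refl (fun h : ℝ => (h ^ k)⁻¹) (𝓝[>] (0 : ℝ))).mul h3).congr' ?_ ?_ <;>
    · filter_upwards [hpos] with h hh
      field_simp
  have h5 : Tendsto (fun _ : ℝ => c k u - d k u) (𝓝[>] (0 : ℝ)) (𝓝 0) :=
    h4.trans_tendsto (tendsto_id.mono_left nhdsWithin_le_nhds)
  exact sub_eq_zero.1 (tendsto_nhds_unique tendsto_const_nhds h5)

/-! ### Gluing infinitely many small perturbations into one smooth curve. -/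

section Bumps

variable {E : Type*} [NormedAddCommGroup E] [NormedSpace ℝ E]

lemma exists_bound_iteratedFDeriv {g : ℝ → E} (hg : ContDiff ℝ ∞ g) (hs : HasCompactSupport g)
    (n : ℕ) : ∃ R : ℝ, 1 ≤ R ∧ ∀ i ≤ n, ∀ x, ‖iteratedFDeriv ℝ i g x‖ ≤ R := by
  have h (i : ℕ) : ∃ R, ∀ x, ‖iteratedFDeriv ℝ i g x‖ ≤ R :=
    (hs.iteratedFDeriv i).exists_bound_of_continuous
      (hg.continuous_iteratedFDeriv (by exact_mod_cast le_top))
  choose R hR using h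
  refine ⟨1 + ∑ i ∈ Finset.range (n + 1), |R i|, ?_, fun i hi x => ?_⟩
  · exact le_add_of_nonneg_right (Finset.sum_nonneg fun i _ => abs_nonneg _)
  · have := Finset.single_le_sum (f := fun i => |R i|) (fun i _ => abs_nonneg _)
      (Finset.mem_range_succ_iff.2 hi)
    linarith [hR i x, le_abs_self (R i)]

/-- A smooth curve which agrees near the points of a null sequence `t n` with small multiples of
translates of `P - (h n)^2 Q`, where `h n` is much smaller than the scaling factor `ε n`. -/
lemma exists_contDiff_eq_near_seq [CompleteSpace E] {P Q : ℝ → E} (hP : ContDiff ℝ ∞ P) (hQ : ContDiff ℝ ∞ Q) :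
    ∃ (φ : ℝ → E) (t ε h : ℕ → ℝ), ContDiff ℝ ∞ φ ∧ Tendsto t atTop (𝓝 0) ∧
      Tendsto ε atTop (𝓝 0) ∧ Tendsto h atTop (𝓝 0) ∧ Tendsto (fun n => h n / ε n) atTop (𝓝 0) ∧
      (∀ n, 0 < ε n) ∧ (∀ n, 0 < h n) ∧
      ∀ n s, |s - t n| ≤ h n → φ s = ε n • (P (s - t n) - h n ^ 2 • Q (s - t n)) := by
  set t : ℕ → ℝ := fun n => (1 / 4 : ℝ) ^ n with ht
  have htpos : ∀ n, 0 < t n := fun n => by positivity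
  have ht1 : ∀ n, t n ≤ 1 := fun n => pow_le_one₀ (by norm_num) (by norm_num)
  have htlt : ∀ i j, i < j → 4 * t j ≤ t i := by
    intro i j hij
    obtain ⟨d, rfl⟩ := Nat.exists_eq_add_of_lt hij
    have : (1 / 4 : ℝ) ^ d ≤ 1 := pow_le_one₀ (by norm_num) (by norm_num)
    have h2 := htpos i
    simp only [ht, pow_add, pow_one] at h2 ⊢
    nlinarith
  -- Since `t` shrinks by a factor 4, the bump at `t k` vanishes on the interval of radius `t n / 8`
  -- about `t n` for every `k ≠ n`.
  let χ : ∀ n, ContDiffBump (t n) := fun n =>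
    ⟨t n / 8, t n / 4, by have := htpos n; positivity, by have := htpos n; linarith⟩
  set A : ℕ → ℝ → E := fun n s => χ n s • P (s - t n) with hA
  set B : ℕ → ℝ → E := fun n s => χ n s • Q (s - t n) with hB
  have hAs : ∀ n, ContDiff ℝ ∞ (A n) := fun n =>
    (χ n).contDiff.smul (hP.comp (contDiff_id.sub contDiff_const))
  have hBs : ∀ n, ContDiff ℝ ∞ (B n) := fun n =>
    (χ n).contDiff.smul (hQ.comp (contDiff_id.sub contDiff_const))
  have hAc : ∀ n, HasCompactSupport (A n) := fun n => (χ n).hasCompactSupport.smul_right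
  have hBc : ∀ n, HasCompactSupport (B n) := fun n => (χ n).hasCompactSupport.smul_right
  choose RA hRA1 hRA using fun n => exists_bound_iteratedFDeriv (hAs n) (hAc n) n
  choose RB hRB1 hRB using fun n => exists_bound_iteratedFDeriv (hBs n) (hBc n) n
  -- Diagonal choice: `RA n` and `RB n` bound derivatives up to order `n`, so for each fixed order
  -- all but finitely many terms are bounded by `2^(-n)`.
  set ε : ℕ → ℝ := fun n => (1 / 2 : ℝ) ^ n / (RA n + RB n) with hε
  have hRpos : ∀ n, 1 ≤ RA n + RB n := fun n => by linarith [hRA1 n, hRB1 n]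
  have hεpos : ∀ n, 0 < ε n := fun n => div_pos (by positivity) (by linarith [hRpos n])
  have hεle : ∀ n, ε n ≤ (1 / 2 : ℝ) ^ n := fun n => div_le_self (by positivity) (hRpos n)
  -- The first entry forces `h n / ε n → 0`; the second keeps `|s - t n| ≤ h n` inside the region
  -- where the bump equals 1.
  set h : ℕ → ℝ := fun n => min (ε n * (1 / 2 : ℝ) ^ n) (t n / 8) with hh
  have hhpos : ∀ n, 0 < h n := fun n =>
    lt_min (mul_pos (hεpos n) (by positivity)) (by have := htpos n; positivity)
  have hht : ∀ n, h n ≤ t n / 8 := fun n => min_le_right _ _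
  have hhε : ∀ n, h n / ε n ≤ (1 / 2 : ℝ) ^ n := fun n => by
    rw [div_le_iff₀ (hεpos n), mul_comm]
    exact min_le_left _ _
  have hh2 : ∀ n, h n ^ 2 ≤ 1 := fun n =>
    pow_le_one₀ (hhpos n).le (by linarith [hht n, ht1 n])
  have hhalf : Tendsto (fun n : ℕ => (1 / 2 : ℝ) ^ n) atTop (𝓝 0) :=
    tendsto_pow_atTop_nhds_zero_of_lt_one (by norm_num) (by norm_num)
  have ht0 : Tendsto t atTop (𝓝 0) :=
    tendsto_pow_atTop_nhds_zero_of_lt_one (by norm_num) (by norm_num)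
  set f : ℕ → ℝ → E := fun n s => ε n • (A n s - h n ^ 2 • B n s) with hf
  have hfs : ∀ n, ContDiff ℝ ∞ (f n) := fun n =>
    ((hAs n).sub ((hBs n).const_smul _)).const_smul _
  refine ⟨fun s => ∑' n, f n s, t, ε, h, ?_, ht0, ?_, ?_, ?_, hεpos, hhpos, ?_⟩
  · refine contDiff_tsum_of_eventually (N := ⊤) (v := fun _ n => (1 / 2 : ℝ) ^ n) hfs
      (fun k _ => summable_geometric_two) fun k _ => ?_
    rw [Nat.cofinite_eq_atTop]
    filter_upwards [eventually_ge_atTop k] with n hn s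
    have hAk : ContDiffAt ℝ k (A n) s := (hAs n).contDiffAt.of_le (by exact_mod_cast le_top)
    have hBk : ContDiffAt ℝ k (B n) s := (hBs n).contDiffAt.of_le (by exact_mod_cast le_top)
    have hBk' : ContDiffAt ℝ k (h n ^ 2 • B n) s := hBk.const_smul _
    have hABk : ContDiffAt ℝ k (A n - h n ^ 2 • B n) s := hAk.sub hBk'
    have e1 : f n = ε n • (A n - h n ^ 2 • B n) := rfl
    rw [e1, iteratedFDeriv_const_smul_apply hABk,
      iteratedFDeriv_sub_apply hAk hBk', iteratedFDeriv_const_smul_apply hBk,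
      norm_smul, Real.norm_of_nonneg (hεpos n).le]
    have h1 := norm_sub_le (iteratedFDeriv ℝ k (A n) s) (h n ^ 2 • iteratedFDeriv ℝ k (B n) s)
    rw [norm_smul, Real.norm_of_nonneg (sq_nonneg (h n))] at h1
    have h2 : h n ^ 2 * ‖iteratedFDeriv ℝ k (B n) s‖ ≤ ‖iteratedFDeriv ℝ k (B n) s‖ :=
      mul_le_of_le_one_left (norm_nonneg _) (hh2 n)
    calc _ ≤ ε n * (RA n + RB n) := by
          refine mul_le_mul_of_nonneg_left ?_ (hεpos n).le
          linarith [hRA n k hn s, hRB n k hn s]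
      _ = (1 / 2 : ℝ) ^ n := div_mul_cancel₀ _ (by linarith [hRpos n])
  · exact squeeze_zero (fun n => (hεpos n).le) hεle hhalf
  · refine squeeze_zero (fun n => (hhpos n).le) (fun n => ?_) ht0
    linarith [hht n, htpos n]
  · exact squeeze_zero (fun n => (div_pos (hhpos n) (hεpos n)).le) hhε hhalf
  · intro n s hs
    have hs' := abs_le.1 (hs.trans (hht n))
    have hχ : χ n s = 1 := (χ n).one_of_mem_closedBall (by
      rw [Metric.mem_closedBall, Real.dist_eq]
      exact hs.trans (hht n))
    have hzero : ∀ k, k ≠ n → f k s = 0 := by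
      intro k hk
      have : χ k s = 0 := (χ k).zero_of_le_dist (by
        rw [Real.dist_eq]
        change t k / 4 ≤ _
        have hk0 := htpos k
        rcases hk.lt_or_gt with hk | hk
        · have := htlt _ _ hk
          rw [abs_sub_comm]
          exact le_trans (by linarith [hs'.2]) (le_abs_self _)
        · have := htlt _ _ hk
          exact le_trans (by linarith [hs'.1]) (le_abs_self _))
      simp [hf, hA, hB, this]
    change ∑' n, f n s = _
    rw [tsum_eq_single n hzero]
    simp [hf, hA, hB, hχ]

end Bumps

/-! ### Invariance under perturbations that vanish at both endpoints. -/

/-- If `P - h^2 Q` vanishes at `± h/2` for all `h`, then the expansion of a function of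
`x(t - h/2)`, `x(t + h/2)` and `h` is invariant in the direction of the jet of `P - h^2 Q`. -/
lemma IsDiscreteLagrangianSeries.dirDeriv_eq
    {Ldisc : EuclideanSpace ℝ (Fin N) → EuclideanSpace ℝ (Fin N) → ℝ → ℝ}
    {c : ℕ → Jet N → ℝ} (hc : IsDiscreteLagrangianSeries Ldisc c)
    {P Q : ℝ → EuclideanSpace ℝ (Fin N)} (hP : ContDiff ℝ ∞ P) (hQ : ContDiff ℝ ∞ Q)
    (hpos : ∀ h : ℝ, P (h / 2) = h ^ 2 • Q (h / 2))
    (hneg : ∀ h : ℝ, P (-(h / 2)) = h ^ 2 • Q (-(h / 2))) (k : ℕ) (u : Jet N) :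
    dirDeriv (c k) (jet P 0) u = if 2 ≤ k then dirDeriv (c (k - 2)) (jet Q 0) u else 0 := by
  obtain ⟨φ, t, ε, h, hφ, ht, hε, hh, hhε, hεpos, hhpos, hφeq⟩ := exists_contDiff_eq_near_seq hP hQ
  set a := jet P 0 with ha
  set b := jet Q 0 with hb
  -- `B k` is the coefficient of `h^k` in `h^2 ∑ h^i dc_i(b)`, so the claim is that `∑ h^k dc_k(a -
  -- h^2 b)` vanishes formally.
  let B : ℕ → Jet N → ℝ := fun k u => if 2 ≤ k then dirDeriv (c (k - 2)) b u else 0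
  have hBs : ∀ k, IsSmoothOfFiniteOrder (B k) := by
    intro k
    by_cases hk : 2 ≤ k
    · simp only [B, if_pos hk]
      exact (hc.1 (k - 2)).dirDeriv b
    · simp only [B, if_neg hk]
      exact ⟨0, fun _ => 0, contDiff_const, fun _ => rfl⟩
  change _ = B k u
  induction k using Nat.strong_induction_on generalizing u with
  | _ K ih =>
  obtain ⟨n₁, hn₁⟩ := ((hc.1 K).dirDeriv a).dependsOn_Iio
  obtain ⟨n₂, hn₂⟩ := (hBs K).dependsOn_Iio
  have hx := contDiff_polyCurve (n₁ + n₂) u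
  set x := polyCurve (n₁ + n₂) u with hxdef
  have hxu : ∀ i < n₁ + n₂, u i = jet x 0 i := fun i hi => by
    rw [hxdef, jet_polyCurve _ _ _ hi]
  rw [hn₁ (fun i hi => hxu i (Nat.lt_add_right _ hi)),
    hn₂ (fun i hi => hxu i (Nat.lt_add_left _ hi))]
  -- the perturbed curve
  set W : ℕ → Jet N := fun n => a - h n ^ 2 • b with hW
  have hjet : ∀ n, jet (fun s => x s + φ s) (t n) = jet x (t n) + ε n • W n := by
    intro n
    ext1 i
    have hev : φ =ᶠ[𝓝 (t n)] fun s => ε n • (P (s - t n) - h n ^ 2 • Q (s - t n)) := by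
      filter_upwards [Metric.closedBall_mem_nhds (t n) (hhpos n)] with s hs
      exact hφeq n s (by rwa [Metric.mem_closedBall, Real.dist_eq] at hs)
    have hle : ((i : ℕ∞) : WithTop ℕ∞) ≤ ∞ := by exact_mod_cast le_top
    have e1 : iteratedDeriv i φ (t n) =
        ε n • (iteratedDeriv i P 0 - h n ^ 2 • iteratedDeriv i Q 0) := by
      rw [hev.iteratedDeriv_eq,
        iteratedDeriv_comp_sub_const i (fun s => ε n • (P s - h n ^ 2 • Q s)) (t n)]
      beta_reduce
      rw [sub_self,
        iteratedDeriv_fun_const_smul_field, iteratedDeriv_fun_sub, iteratedDeriv_fun_const_smul_field]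
      · exact (hP.of_le hle).contDiffAt
      · exact ((hQ.const_smul _).of_le hle).contDiffAt
    simp only [jet]
    rw [iteratedDeriv_fun_add (hx.of_le hle).contDiffAt (hφ.of_le hle).contDiffAt, e1]
    rfl
  have hφ0 : ∀ n, φ (t n + h n / 2) = 0 ∧ φ (t n - h n / 2) = 0 := by
    intro n
    have hp := hhpos n
    constructor
    · rw [hφeq n _ (by rw [add_sub_cancel_left, abs_of_pos (by linarith)]; linarith),
        add_sub_cancel_left, hpos, sub_self, smul_zero]
    · have e : t n - h n / 2 - t n = -(h n / 2) := by ring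
      rw [hφeq n _ (by rw [e, abs_neg, abs_of_pos (by linarith)]; linarith), e, hneg, sub_self,
        smul_zero]
  -- comparison of the two expansions
  have htend : Tendsto (fun n => (t n, h n)) atTop (𝓝 0 ×ˢ 𝓝[>] (0 : ℝ)) :=
    ht.prodMk (tendsto_nhdsWithin_iff.2 ⟨hh, Eventually.of_forall hhpos⟩)
  -- The curves `x` and `x + φ` agree at `t n ± h n / 2`, so they give the same value of `Ldisc`,
  -- and their truncated expansions differ only by the remainders.
  have hO : (fun n => ∑ k ∈ Finset.range (K + 1), h n ^ k * c k (jet x (t n) + ε n • W n) -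
      ∑ k ∈ Finset.range (K + 1), h n ^ k * c k (jet x (t n))) =O[atTop]
      (fun n => h n ^ (K + 1)) := by
    have h1 := (hc.2 x hx 0 (K + 1)).comp_tendsto htend
    have h2 := (hc.2 (fun s => x s + φ s) (hx.add hφ) 0 (K + 1)).comp_tendsto htend
    refine (h1.sub h2).congr_left fun n => ?_
    simp only [Function.comp_def, hjet, (hφ0 n).1, (hφ0 n).2, add_zero]
    ring
  -- mean value theorem in the amplitude of the perturbation
  let Ψ : ℝ → Jet N → ℝ := fun s z => dirDeriv (c K) a z - B K z - s * B (K + 1) z -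
    s ^ 2 * B (K + 2) z
  have hder : ∀ n s, HasDerivAt (fun s : ℝ =>
      ∑ k ∈ Finset.range (K + 1), h n ^ k * c k (jet x (t n) + s • W n))
      (h n ^ K * Ψ (h n) (jet x (t n) + s • W n)) s := by
    intro n s
    set z := jet x (t n) + s • W n with hz
    have hd := HasDerivAt.fun_sum fun k (_ : k ∈ Finset.range (K + 1)) =>
      ((hc.1 k).hasDerivAt_add_smul (jet x (t n)) (W n) s).const_mul (h n ^ k)
    refine hd.congr_deriv ?_
    have hsplit : ∀ k, dirDeriv (c k) (W n) z = dirDeriv (c k) a z - h n ^ 2 * B (k + 2) z := by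
      intro k
      rw [hW]
      simp only [B, if_pos (Nat.le_add_left 2 k), Nat.add_sub_cancel]
      rw [sub_eq_add_neg, ← neg_smul, (hc.1 k).dirDeriv_add, (hc.1 k).dirDeriv_smul]
      ring
    rw [← hz]
    simp only [hsplit, mul_sub, Finset.sum_sub_distrib]
    have hB2 : ∑ k ∈ Finset.range (K + 1), h n ^ k * (h n ^ 2 * B (k + 2) z) =
        ∑ k ∈ Finset.range (K + 3), h n ^ k * B k z := by
      rw [Finset.sum_range_succ' _ (K + 2), Finset.sum_range_succ' _ (K + 1)]
      simp only [B, show ¬ 2 ≤ 0 + 1 by norm_num, show ¬ 2 ≤ 0 by norm_num, if_false, mul_zero,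
        add_zero]
      refine Finset.sum_congr rfl fun k _ => ?_
      ring_nf
    rw [hB2, Finset.sum_range_succ _ (K + 2), Finset.sum_range_succ _ (K + 1),
      Finset.sum_range_succ _ K, Finset.sum_range_succ _ K,
      Finset.sum_congr rfl fun k hk => by rw [ih k (Finset.mem_range.1 hk) z]]
    ring
  have hmvt : ∀ n, ∃ ξ ∈ Set.Ioo 0 (ε n),
      ∑ k ∈ Finset.range (K + 1), h n ^ k * c k (jet x (t n) + ε n • W n) -
      ∑ k ∈ Finset.range (K + 1), h n ^ k * c k (jet x (t n)) =
      ε n * (h n ^ K * Ψ (h n) (jet x (t n) + ξ • W n)) := by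
    intro n
    obtain ⟨ξ, hξ, he⟩ := exists_hasDerivAt_eq_slope _ _ (hεpos n)
      (fun s _ => (hder n s).continuousAt.continuousWithinAt) (fun s _ => hder n s)
    refine ⟨ξ, hξ, ?_⟩
    rw [he]
    simp only [zero_smul, add_zero, sub_zero]
    rw [mul_div_cancel₀ _ (hεpos n).ne']
  choose ξ hξ hξeq using hmvt
  have hΨ0 : Tendsto (fun n => Ψ (h n) (jet x (t n) + ξ n • W n)) atTop (𝓝 0) := by
    -- Dividing `O(h^(K+1))` by `ε h^K` leaves `O(h / ε)`: this is why `h` must be much smaller than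
    -- `ε`.
    have h1 : (fun n => Ψ (h n) (jet x (t n) + ξ n • W n)) =O[atTop] fun n => h n / ε n := by
      refine ((isBigO_refl (fun n => (ε n * h n ^ K)⁻¹) atTop).mul hO).congr (fun n => ?_)
        (fun n => ?_)
      · rw [hξeq n]
        have := (hεpos n).ne'
        have := (hhpos n).ne'
        field_simp
      · have := (hεpos n).ne'
        have := (hhpos n).ne'
        rw [pow_succ]
        field_simp
    exact h1.trans_tendsto hhε
  have hz : Tendsto (fun n => jet x (t n) + ξ n • W n) atTop (𝓝 (jet x 0)) := by
    have h1 : Tendsto (fun n => jet x (t n)) atTop (𝓝 (jet x 0)) :=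
      tendsto_pi_nhds.2 fun i => ((contDiff_jet hx i).continuous.tendsto 0).comp ht
    have h2 : Tendsto ξ atTop (𝓝 0) :=
      squeeze_zero (fun n => (hξ n).1.le) (fun n => (hξ n).2.le) hε
    have h3 : Tendsto W atTop (𝓝 (a - (0 : ℝ) ^ 2 • b)) :=
      tendsto_const_nhds.sub ((hh.pow 2).smul_const b)
    simpa using h1.add (h2.smul h3)
  have hΨ1 : Tendsto (fun n => Ψ (h n) (jet x (t n) + ξ n • W n)) atTop (𝓝 (Ψ 0 (jet x 0))) := by
    have hcomp : ∀ {f : Jet N → ℝ}, IsSmoothOfFiniteOrder f →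
        Tendsto (fun n => f (jet x (t n) + ξ n • W n)) atTop (𝓝 (f (jet x 0))) :=
      fun hf => (hf.continuous.tendsto _).comp hz
    exact (((hcomp ((hc.1 K).dirDeriv a)).sub (hcomp (hBs K))).sub
      (hh.mul (hcomp (hBs (K + 1))))).sub ((hh.pow 2).mul (hcomp (hBs (K + 2))))
  have := tendsto_nhds_unique hΨ1 hΨ0
  simp only [Ψ] at this
  linarith

lemma jet_monomial_smul (i : ℕ) (v : EuclideanSpace ℝ (Fin N)) :
    jet (fun t : ℝ => (t ^ i / (i.factorial : ℝ)) • v) 0 = Pi.single i v := by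
  ext1 k
  rw [jet, iteratedDeriv_monomial_smul]
  rcases lt_trichotomy k i with h | rfl | h
  · have : i - k ≠ 0 := by omega
    simp [h.le, h.ne, this]
  · simp
  · simp [h.not_ge, h.ne']

/-! ### The generating function of the mesh coefficients. -/

/-- The coefficients of `(z/2) / sinh (z/2)`. -/
noncomputable def meshCoeff (n : ℕ) : ℝ :=
  ((2 : ℝ) ^ (1 - (n : ℤ)) - 1) * ((bernoulli n : ℚ) : ℝ) / (n.factorial : ℝ)

/-- At `n = 1` the Bernoulli number is nonzero, but the factor `2^(1-n) - 1` vanishes. Thus the even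
terms in the mesh sum already form the full power series. -/
lemma meshCoeff_of_odd {n : ℕ} (hn : Odd n) : meshCoeff n = 0 := by
  rcases Nat.lt_or_ge 1 n with h | h
  · simp [meshCoeff, bernoulli_eq_zero_of_odd hn h]
  · have : n = 1 := le_antisymm h hn.pos
    simp [meshCoeff, this]

open PowerSeries in
-- With `β(z) = z/(e^z - 1)`, the left factor is `2β(z/2) - β(z) = z e^(z/2)/(e^z - 1)`, which is
-- `z` divided by `e^(z/2) - e^(-z/2)`.
lemma mk_meshCoeff_mul_exp :
    (mk meshCoeff) * (rescale (1 / 2 : ℝ) (exp ℝ) - rescale (-1 / 2 : ℝ) (exp ℝ)) = X := by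
  set β : PowerSeries ℝ := bernoulliPowerSeries ℝ with hβ
  set e : PowerSeries ℝ := rescale (1 / 2 : ℝ) (exp ℝ) with he
  set e' : PowerSeries ℝ := rescale (-1 / 2 : ℝ) (exp ℝ) with he'
  have hA : mk meshCoeff = 2 * rescale (1 / 2 : ℝ) β - β := by
    ext n
    have h2 : (2 : PowerSeries ℝ) = C (2 : ℝ) := (map_ofNat C 2).symm
    rw [h2, map_sub, coeff_C_mul, coeff_rescale, coeff_mk, hβ, bernoulliPowerSeries, coeff_mk,
      meshCoeff, zpow_sub₀ (by norm_num), zpow_one, zpow_natCast]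
    simp
    ring
  have h1 : β * (exp ℝ - 1) = X := bernoulliPowerSeries_mul_exp_sub_one ℝ
  have h2 : 2 * (rescale (1 / 2 : ℝ) β * (e - 1)) = X := by
    have := congrArg (rescale (1 / 2 : ℝ)) h1
    rw [map_mul, map_sub, map_one, rescale_X] at this
    rw [he, this]
    have h2 : (2 : PowerSeries ℝ) = C (2 : ℝ) := (map_ofNat C 2).symm
    rw [h2, ← mul_assoc, ← map_mul]
    norm_num
  have h3 : e * e = exp ℝ := by
    rw [he, exp_mul_exp_eq_exp_add]
    norm_num
  have h4 : e * e' = 1 := by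
    rw [he, he', exp_mul_exp_eq_exp_add]
    norm_num
  rw [hA]
  have key : (2 * rescale (1 / 2 : ℝ) β - β) * (exp ℝ - 1) = X * e := by
    rw [← h3] at h1 ⊢
    linear_combination (e + 1) * h2 - h1
  calc (2 * rescale (1 / 2 : ℝ) β - β) * (e - e')
      = (2 * rescale (1 / 2 : ℝ) β - β) * (exp ℝ - 1) * e' := by
        rw [← h3]
        linear_combination -(2 * rescale (1 / 2 : ℝ) β - β) * e * h4
    _ = X := by
        rw [key]
        linear_combination X * h4

lemma sum_range_two_mul {f : ℕ → ℝ} (n : ℕ) (h : ∀ i, f (2 * i + 1) = 0) :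
    ∑ i ∈ Finset.range (2 * n), f i = ∑ i ∈ Finset.range n, f (2 * i) := by
  induction n with
  | zero => simp
  | succ n ih => rw [mul_add, mul_one, Finset.sum_range_succ, Finset.sum_range_succ, ih,
      Finset.sum_range_succ, h, add_zero]

/-- The vanishing of the higher coefficients of `(z/2) / sinh (z/2) * sinh (z/2) / (z/2)`. -/
lemma sum_meshCoeff_eq_zero {q : ℕ} (hq : 1 ≤ q) :
    ∑ i ∈ Finset.range (q + 1), meshCoeff (2 * i) *
      ((1 / 2 : ℝ) ^ (2 * (q - i)) / ((2 * (q - i) + 1).factorial : ℝ)) = 0 := by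
  -- The degree is `2q + 1` because the identity carries an extra factor `z`; the exponential factor
  -- is `2 sinh(z/2)`.
  have h := congrArg (PowerSeries.coeff (2 * q + 1)) mk_meshCoeff_mul_exp
  rw [PowerSeries.coeff_X, if_neg (by omega), PowerSeries.coeff_mul,
    Finset.Nat.sum_antidiagonal_eq_sum_range_succ_mk,
    show (2 * q + 1).succ = 2 * (q + 1) by omega, sum_range_two_mul] at h
  · rw [← h]
    refine Finset.sum_congr rfl fun i hi => ?_
    have hi' := Finset.mem_range_succ_iff.1 hi
    have e1 : 2 * q + 1 - 2 * i = 2 * (q - i) + 1 := by omega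
    simp only [PowerSeries.coeff_mk, map_sub, PowerSeries.coeff_rescale, PowerSeries.coeff_exp, e1]
    rw [neg_div, Odd.neg_pow ⟨q - i, rfl⟩, pow_succ]
    simp
    left
    ring
  · intro i
    simp only [PowerSeries.coeff_mk, meshCoeff_of_odd ⟨i, rfl⟩, zero_mul]

/-! ### Consequences of the two-point recursion for the order. -/

/-- The relation between the partial derivatives of the coefficients of `∑ k, h^k c_k` which says
that this series is a function of `x(t - h/2)` and `x(t + h/2)` only. -/
def IsTwoPointSeries (c : ℕ → Jet N → ℝ) : Prop :=
  (∀ k < 2, ∀ m v u, dirDeriv (c k) (Pi.single (m + 2) v) u = 0) ∧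
    ∀ k m v u, dirDeriv (c (k + 2)) (Pi.single (m + 2) v) u =
      1 / (4 * (m + 1) * (m + 2)) * dirDeriv (c k) (Pi.single m v) u

namespace IsTwoPointSeries

/-- The recursion lowers `k` and `j` together by 2, preserving `j - k > 1`, until `k < 2`, where the
derivative vanishes. -/
lemma dirDeriv_eq_zero {c : ℕ → Jet N → ℝ} (h : IsTwoPointSeries c) (k j : ℕ) (hj : k + 1 < j)
    (v : EuclideanSpace ℝ (Fin N)) (u : Jet N) : dirDeriv (c k) (Pi.single j v) u = 0 := by
  induction k using Nat.twoStepInduction generalizing j with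
  | zero =>
    obtain ⟨m, rfl⟩ := Nat.exists_eq_add_of_le' (show 2 ≤ j by omega)
    exact h.1 0 (by norm_num) m v u
  | one =>
    obtain ⟨m, rfl⟩ := Nat.exists_eq_add_of_le' (show 2 ≤ j by omega)
    exact h.1 1 (by norm_num) m v u
  | more k ih _ =>
    obtain ⟨m, rfl⟩ := Nat.exists_eq_add_of_le' (show 2 ≤ j by omega)
    rw [h.2, ih m (by omega), mul_zero]

lemma dependsOn {c : ℕ → Jet N → ℝ} (h : IsTwoPointSeries c)
    (hc : ∀ k, IsSmoothOfFiniteOrder (c k)) (k : ℕ) : DependsOn (c k) (Set.Iic (k + 1)) :=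
  (hc k).dependsOn_of_dirDeriv_eq_zero (k + 1) fun j hj v u => h.dirDeriv_eq_zero k j hj v u

/-- Descending along `j = k + 1` ends at `∂c_0/∂ẋ`; the factors `1/(4(2p+2)(2p+3))` multiply up to
the coefficients of `sinh(z/2)/(z/2)`. -/
lemma dirDeriv_top_even {c : ℕ → Jet N → ℝ} (h : IsTwoPointSeries c) (p : ℕ)
    (v : EuclideanSpace ℝ (Fin N)) (u : Jet N) :
    dirDeriv (c (2 * p)) (Pi.single (2 * p + 1) v) u =
      (1 / 2 : ℝ) ^ (2 * p) / ((2 * p + 1).factorial : ℝ) * dirDeriv (c 0) (Pi.single 1 v) u := by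
  induction p with
  | zero => simp
  | succ p ih =>
    rw [show 2 * (p + 1) + 1 = (2 * p + 1) + 2 by ring, show 2 * (p + 1) = 2 * p + 2 by ring,
      h.2, ih, Nat.factorial_succ (2 * p + 1 + 1), Nat.factorial_succ (2 * p + 1)]
    have : ((2 * p + 1).factorial : ℝ) ≠ 0 := by exact_mod_cast Nat.factorial_ne_zero _
    push_cast
    field_simp
    ring

lemma dirDeriv_top_odd {c : ℕ → Jet N → ℝ} (h : IsTwoPointSeries c) (p : ℕ)
    (v : EuclideanSpace ℝ (Fin N)) (u : Jet N) :
    dirDeriv (c (2 * p + 1)) (Pi.single (2 * p + 2) v) u = 0 := by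
  induction p with
  | zero => exact h.1 1 (by norm_num) 0 v u
  | succ p ih =>
    rw [show 2 * (p + 1) + 1 = (2 * p + 1) + 2 by ring, h.2,
      show 2 * (p + 1) = 2 * p + 2 by ring, ih, mul_zero]

/-- The coefficient of `h^l` in the meshed modified Lagrangian has order at most `l`. -/
theorem dependsOn_meshTerm {c : ℕ → Jet N → ℝ} (h : IsTwoPointSeries c)
    (hc : ∀ k, IsSmoothOfFiniteOrder (c k)) {l : ℕ} (hl : 1 ≤ l) :
    DependsOn (meshTerm c l) (Set.Iic l) := by
  have heq : meshTerm c l = fun u => ∑ i ∈ Finset.range (l / 2 + 1),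
      meshCoeff (2 * i) * totalDeriv^[2 * i] (c (l - 2 * i)) u := by
    ext u
    simp [meshTerm, meshCoeff]
  have hs : ∀ i ∈ Finset.range (l / 2 + 1), IsSmoothOfFiniteOrder
      (fun u => meshCoeff (2 * i) * totalDeriv^[2 * i] (c (l - 2 * i)) u) :=
    fun i _ => ((hc _).iterate_totalDeriv _).const_mul _
  rw [heq]
  refine (IsSmoothOfFiniteOrder.sum _ hs).dependsOn_of_dirDeriv_eq_zero l fun j hj v u => ?_
  rw [dirDeriv_sum _ hs]
  simp only [dirDeriv_const_mul]
  -- Every summand has order at most `l + 1`, so only the derivative in `x^(l+1)` needs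
  -- cancellation.
  have hidx : ∀ i ∈ Finset.range (l / 2 + 1), l - 2 * i + 1 + 2 * i = l + 1 := fun i hi => by
    have := Finset.mem_range_succ_iff.1 hi
    omega
  rcases (show l + 1 ≤ j from hj).lt_or_eq with hj | rfl
  · refine Finset.sum_eq_zero fun i hi => ?_
    have hdep := dependsOn_iterate_totalDeriv (h.dependsOn hc (l - 2 * i)) (2 * i)
    rw [hidx i hi] at hdep
    rw [dirDeriv_single_eq_zero hdep hj, mul_zero]
  · have htop : ∀ i ∈ Finset.range (l / 2 + 1),
        dirDeriv (totalDeriv^[2 * i] (c (l - 2 * i))) (Pi.single (l + 1) v) u =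
          dirDeriv (c (l - 2 * i)) (Pi.single (l - 2 * i + 1) v) u := fun i hi => by
      have := dirDeriv_iterate_totalDeriv_top (hc _) (h.dependsOn hc (l - 2 * i)) (2 * i) v u
      rwa [hidx i hi] at this
    rw [Finset.sum_congr rfl fun i hi => by rw [htop i hi]]
    rcases Nat.even_or_odd' l with ⟨q, rfl | rfl⟩
    · rw [Nat.mul_div_cancel_left q (by norm_num)]
      have : ∀ i ∈ Finset.range (q + 1), meshCoeff (2 * i) *
          dirDeriv (c (2 * q - 2 * i)) (Pi.single (2 * q - 2 * i + 1) v) u =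
          meshCoeff (2 * i) * ((1 / 2 : ℝ) ^ (2 * (q - i)) / ((2 * (q - i) + 1).factorial : ℝ)) *
            dirDeriv (c 0) (Pi.single 1 v) u := fun i _ => by
        rw [← Nat.mul_sub, h.dirDeriv_top_even, mul_assoc]
      rw [Finset.sum_congr rfl this, ← Finset.sum_mul, sum_meshCoeff_eq_zero (by omega), zero_mul]
    · refine Finset.sum_eq_zero fun i hi => ?_
      have := Finset.mem_range_succ_iff.1 hi
      rw [show 2 * q + 1 - 2 * i = 2 * (q - i) + 1 by omega, h.dirDeriv_top_odd, mul_zero]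

end IsTwoPointSeries

/-! ### The recursion and the series for the given discretization. -/

/-- Monomials have jets concentrated in a single entry, and at `t = ± h/2` the ratio of
`t^(m+2)/(m+2)!` to `t^m/m!` is `h^2/(4(m+1)(m+2))`. -/
lemma IsDiscreteLagrangianSeries.isTwoPointSeries
    {Ldisc : EuclideanSpace ℝ (Fin N) → EuclideanSpace ℝ (Fin N) → ℝ → ℝ}
    {c : ℕ → Jet N → ℝ} (hc : IsDiscreteLagrangianSeries Ldisc c) : IsTwoPointSeries c := by
  have key : ∀ k m v u, dirDeriv (c k) (Pi.single (m + 2) v) u = if 2 ≤ k then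
      1 / (4 * (m + 1) * (m + 2)) * dirDeriv (c (k - 2)) (Pi.single m v) u else 0 := by
    intro k m v u
    have hf : ((m.factorial : ℕ) : ℝ) ≠ 0 := by exact_mod_cast m.factorial_ne_zero
    have hfac : (((m + 2).factorial : ℕ) : ℝ) = (m + 2) * (m + 1) * m.factorial := by
      rw [Nat.factorial_succ (m + 1), Nat.factorial_succ m]
      push_cast
      ring
    have h := hc.dirDeriv_eq (P := fun t : ℝ => (t ^ (m + 2) / ((m + 2).factorial : ℝ)) • v)
      (Q := fun t : ℝ => (t ^ m / (m.factorial : ℝ)) • (1 / (4 * (m + 1) * (m + 2)) : ℝ) • v)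
      (by fun_prop) (by fun_prop) ?_ ?_ k u
    · rwa [jet_monomial_smul, jet_monomial_smul, Pi.single_smul, (hc.1 _).dirDeriv_smul] at h
    all_goals
      intro h
      simp only [smul_smul]
      congr 1
      rw [hfac]
      field_simp
      ring
  constructor
  · intro k hk m v u
    rw [key, if_neg (by omega)]
  · intro k m v u
    rw [key, if_pos (by omega), Nat.add_sub_cancel]

/-- Moving the base time from the left endpoint to the midpoint is recentering with `a = -1/2`. -/
lemma IsConsistentDiscretization.exists_series
    {Ldisc : EuclideanSpace ℝ (Fin N) → EuclideanSpace ℝ (Fin N) → ℝ → ℝ}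
    {L : EuclideanSpace ℝ (Fin N) → EuclideanSpace ℝ (Fin N) → ℝ}
    (h : IsConsistentDiscretization Ldisc L) : ∃ c, IsDiscreteLagrangianSeries Ldisc c := by
  obtain ⟨g, -, hg⟩ := h
  have key := hg.shift_time (-1 / 2)
  have e : (fun (x : ℝ → EuclideanSpace ℝ (Fin N)) (t h : ℝ) =>
      Ldisc (x (t + -1 / 2 * h)) (x (t + -1 / 2 * h + h)) h) =
      fun x t h => Ldisc (x (t - h / 2)) (x (t + h / 2)) h := by
    ext x t h
    congr 2 <;> ring
  rw [e] at key
  exact ⟨_, key⟩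

end MeshedLagrangian

theorem mainTheorem8 (N : ℕ)
    (L : EuclideanSpace ℝ (Fin N) → EuclideanSpace ℝ (Fin N) → ℝ)
    (Ldisc : EuclideanSpace ℝ (Fin N) → EuclideanSpace ℝ (Fin N) → ℝ → ℝ)
    (hL : ContDiff ℝ ∞
      (fun p : EuclideanSpace ℝ (Fin N) × EuclideanSpace ℝ (Fin N) => L p.1 p.2))
    (hLdisc : ContDiffOn ℝ ∞
      (fun p : EuclideanSpace ℝ (Fin N) × EuclideanSpace ℝ (Fin N) × ℝ =>
        Ldisc p.1 p.2.1 p.2.2) {p | 0 < p.2.2})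
    (hcons : MeshedLagrangian.IsConsistentDiscretization Ldisc L) :
    (∃! c : ℕ → MeshedLagrangian.Jet N → ℝ,
        MeshedLagrangian.IsDiscreteLagrangianSeries Ldisc c) ∧
      ∀ c : ℕ → MeshedLagrangian.Jet N → ℝ,
        MeshedLagrangian.IsDiscreteLagrangianSeries Ldisc c →
          ∀ l : ℕ, 1 ≤ l → DependsOn (MeshedLagrangian.meshTerm c l) (Set.Iic l) := by
  obtain ⟨c₀, hc₀⟩ := hcons.exists_series
  exact ⟨⟨c₀, hc₀, fun c hc => MeshedLagrangian.HasExpansion.unique hc hc₀⟩,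
    fun c hc l hl => hc.isTwoPointSeries.dependsOn_meshTerm hc.1 hl⟩
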